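/- Let $m_1,m_2>0$, $\alpha>1$, $\Omega>0$, $\theta>0$. Let $N_1,N_2,I$ be independent real random variables such that $N_j^2$ ($j=1,2$) has density $$\frac{m_j^{m_j}x^{m_j-1}}{\Omega^{m_j}\Gamma(m_j)}e^{-m_jx/\Omega},\qquad x>0$$ (squared Nakagami-$m_j$ fading with mean square value $\Omega$), and $I$ has the inverse-gamma density $$\frac{\theta^{\alpha}}{\Gamma(\alpha)\,y^{\alpha+1}}e^{-\theta/y},\qquad y>0.$$ Put $\overline\gamma=\Omega^2\theta$ (so $\overline\gamma=\theta$ when $\Omega=1$), $\tilde\gamma=m_1m_2/\overline\gamma$ and $\mathcal S_2=\frac1{\Gamma(m_1)\Gamma(m_2)\Gamma(\alpha)}$. Then the single-shadowing SNR $\gamma^s=(N_1N_2)^2I$ is absolutely continuous, with a density $f$ that vanishes on $(-\infty,0]$ and is positive on $(0,\infty)$, where $$f(\gamma)=\mathcal S_2\,\gamma^{-1}\,G^{2,1}_{1,2}\!\left(\tilde\gamma\gamma\,\Big|\,{1-\alpha\atop m_1,m_2}\right)=\Gamma(\alpha+m_1)\Gamma(\alpha+m_2)\,\mathcal S_2\,\tilde\gamma^{m_1}\gamma^{m_1-1}\,U(\alpha+m_1;\,m_1-m_2+1;\,\tilde\gamma\gamma).$$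 Moreover $\gamma^s$ is integrable with mean $$\mathbb E[\gamma^s]=\frac{\overline\gamma}{\alpha-1}.$$ Here, for $z>0$, the Meijer $G$-function is the Mellin–Barnes integral $$G^{2,1}_{1,2}\!\left(z\,\Big|\,{1-\alpha\atop m_1,m_2}\right)=\frac1{2\pi i}\int_{c-i\infty}^{c+i\infty}\Gamma(m_1-s)\Gamma(m_2-s)\Gamma(\alpha+s)\,z^s\,ds,$$ which converges absolutely for every $c\in(-\alpha,\min(m_1,m_2))$ to a value that does not depend on $c$, and $U$ is Tricomi's confluent hypergeometric function $$U(a;b;z)=\frac1{\Gamma(a)}\int_0^\infty e^{-zt}t^{a-1}(1+t)^{b-a-1}\,dt\qquad(a,z>0).$$ -/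

import Mathlib

open MeasureTheory ProbabilityTheory Set

noncomputable section

/-- Density of the squared envelope of a Nakagami-`m` fading coefficient with shape `m` and
mean square value `Ω`. -/
def nakagamiSqPDF (m Ω x : ℝ) : ℝ :=
  if 0 < x then m ^ m * x ^ (m - 1) / (Ω ^ m * Real.Gamma m) * Real.exp (-(m * x / Ω)) else 0

/-- Density of the inverse-gamma distribution with shape `α` and scale `θ`. -/
def invGammaPDF (α θ y : ℝ) : ℝ :=
  if 0 < y then θ ^ α / (Real.Gamma α * y ^ (α + 1)) * Real.exp (-(θ / y)) else 0

/-- The measure on the real line with Lebesgue density `f`. -/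
def densityMeasure (f : ℝ → ℝ) : Measure ℝ :=
  volume.withDensity (fun x => ENNReal.ofReal (f x))

/-- The integrand of the Mellin-Barnes integral of the Meijer function `G^{m,n}_{p,q}`, with
upper parameters `a` and lower parameters `b`.  (`Complex.Gamma` vanishes at its poles in Lean, so
that dividing by it gives the correct value `0` of the reciprocal Gamma function there.) -/
def meijerIntegrand (m n : ℕ) {p q : ℕ} (a : Fin p → ℂ) (b : Fin q → ℂ) (z s : ℂ) : ℂ :=
  ((∏ j with j.val < m, Complex.Gamma (b j - s)) *
      ∏ j with j.val < n, Complex.Gamma (1 - a j + s)) /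
    ((∏ j with m ≤ j.val, Complex.Gamma (1 - b j + s)) *
      ∏ j with n ≤ j.val, Complex.Gamma (a j - s)) * z ^ s

/-- The vertical line `Re s = c` separates the poles of the `Γ(b_j - s)`, `j ≤ m` (to its right),
from those of the `Γ(1 - a_j + s)`, `j ≤ n` (to its left). -/
def MeijerSeparates (m n : ℕ) {p q : ℕ} (a : Fin p → ℂ) (b : Fin q → ℂ) (c : ℝ) : Prop :=
  (∀ j, j.val < m → c < (b j).re) ∧ (∀ j, j.val < n → (a j).re - 1 < c)

/-- The Mellin-Barnes integral `(1 / 2πi) ∫ ... ds` along the line `Re s = c`, `s = c + i t`. -/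
def mellinBarnes (m n : ℕ) {p q : ℕ} (a : Fin p → ℂ) (b : Fin q → ℂ) (c : ℝ) (z : ℂ) : ℂ :=
  (2 * (Real.pi : ℂ))⁻¹ * ∫ t : ℝ, meijerIntegrand m n a b z ((c : ℂ) + (t : ℂ) * Complex.I)

open Classical in
/-- The Meijer function `G^{m,n}_{p,q}(z | a; b)` for parameters admitting a vertical line that
separates the two families of poles (the value is the junk `0` if there is no such line). -/
def meijerG (m n : ℕ) {p q : ℕ} (a : Fin p → ℂ) (b : Fin q → ℂ) (z : ℂ) : ℂ :=
  if h : ∃ c : ℝ, MeijerSeparates m n a b c then mellinBarnes m n a b h.choose z else 0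

/-- Tricomi's confluent hypergeometric function `U(a; b; z)`, for `0 < a` and `0 < z`. -/
def tricomiU (a b z : ℝ) : ℝ :=
  (Real.Gamma a)⁻¹ *
    ∫ t in Ioi (0 : ℝ), Real.exp (-(z * t)) * t ^ (a - 1) * (1 + t) ^ (b - a - 1)

end

/-! The density is computed twice and the answers are compared. On the real side, two multiplicative
convolutions give it explicitly. Multiplying `N₂²` by `I` yields a scaled beta-prime law
(`hasLaw_nakagamiSq_mul_invGamma`). Multiplying by `N₁²` then yields, after a rescaling, exactly
Tricomi's integral (`hasLaw_singleShadowing`), so positivity and continuity on the half-line are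
visible.

On the Mellin side, the transform of a density at `s` is the moment `E[X^(s-1)]`, hence
multiplicative over independent positive factors (`hasMellin_of_indepFun_mul`). Each factor
contributes one Gamma function, so the density has transform `S₂` times the Meijer integrand at `1 -
s` (`hasMellin_singleShadowingPDF`). Mellin inversion along any separating line recovers the density
(`eq_mellinBarnes_of_hasMellin`). As the density does not involve `c`, neither does the
Mellin–Barnes integral. The mean is the transform at `s = 2`. -/

/-! ### Decay of the Gamma function on vertical lines -/

theorem norm_complex_Gamma_le {s : ℂ} (hs : 0 < s.re) : ‖Complex.Gamma s‖ ≤ Real.Gamma s.re := by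
  rw [Complex.Gamma_eq_integral hs, Real.Gamma_eq_integral hs, Complex.GammaIntegral]
  refine (norm_integral_le_integral_norm _).trans_eq ?_
  refine setIntegral_congr_fun measurableSet_Ioi fun x hx => ?_
  rw [mem_Ioi] at hx
  simp only [norm_mul, Complex.norm_real, Real.norm_eq_abs, abs_of_pos (Real.exp_pos _),
    Complex.norm_cpow_eq_rpow_re_of_pos hx, Complex.sub_re, Complex.one_re]

theorem continuous_Gamma_vertical {a : ℝ} (ha : 0 < a) :
    Continuous fun t : ℝ => Complex.Gamma (a + t * Complex.I) := by
  refine continuous_iff_continuousAt.2 fun t => ?_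
  have h : ContinuousAt Complex.Gamma (a + t * Complex.I) := by
    refine (Complex.differentiableAt_Gamma _ fun m hm => ?_).continuousAt
    have := congrArg Complex.re hm
    simp at this
    have : (0 : ℝ) ≤ m := Nat.cast_nonneg m
    linarith
  exact ContinuousAt.comp (f := fun t : ℝ => (a : ℂ) + t * Complex.I) h (by fun_prop)

/-- Stirling is not needed: `s (s + 1) Γ(s) = Γ(s + 2)` is bounded on the line, so `Γ(s)` decays
like `|s|⁻²`. -/
theorem integrable_Gamma_vertical {a : ℝ} (ha : 0 < a) :
    Integrable fun t : ℝ => Complex.Gamma (a + t * Complex.I) := by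
  have hint : Integrable fun t : ℝ => Real.Gamma (a + 2) * (a ^ 2 + t ^ 2)⁻¹ := by
    refine Integrable.const_mul ?_ _
    have h := (integrable_inv_one_add_sq.comp_div ha.ne').const_mul (a ^ 2)⁻¹
    refine h.congr (Filter.Eventually.of_forall fun t => ?_)
    simp only
    rw [← mul_inv]
    congr 1
    field_simp
  refine hint.mono' (continuous_Gamma_vertical ha).aestronglyMeasurable
    (Filter.Eventually.of_forall fun t => ?_)
  set s : ℂ := a + t * Complex.I with hs
  have hre : s.re = a := by simp [hs]
  have him : s.im = t := by simp [hs]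
  have h0 : s ≠ 0 := fun h => by rw [h] at hre; simp at hre; linarith
  have h1 : s + 1 ≠ 0 := fun h => by
    have := congrArg Complex.re h
    simp [hre] at this
    linarith
  have key : s * (s + 1) * Complex.Gamma s = Complex.Gamma (s + 2) := by
    rw [show s + 2 = s + 1 + 1 by ring, Complex.Gamma_add_one _ h1, Complex.Gamma_add_one _ h0]
    ring
  have hle : ‖s‖ ≤ ‖s + 1‖ := by
    rw [Complex.norm_def, Complex.norm_def]
    refine Real.sqrt_le_sqrt ?_
    simp only [Complex.normSq_apply, Complex.add_re, Complex.add_im, Complex.one_re,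
      Complex.one_im, hre, him]
    nlinarith
  have hsq : ‖s‖ ^ 2 = a ^ 2 + t ^ 2 := by
    rw [Complex.sq_norm, Complex.normSq_apply, hre, him]; ring
  have hG : ‖Complex.Gamma (s + 2)‖ ≤ Real.Gamma (a + 2) := by
    have h := norm_complex_Gamma_le (s := s + 2) (by simp [hre]; linarith)
    simpa [hre] using h
  rw [← div_eq_mul_inv, le_div_iff₀ (by positivity), ← hsq]
  calc ‖Complex.Gamma s‖ * ‖s‖ ^ 2 = ‖s‖ * ‖s‖ * ‖Complex.Gamma s‖ := by ring
    _ ≤ ‖s‖ * ‖s + 1‖ * ‖Complex.Gamma s‖ := by gcongr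
    _ = ‖Complex.Gamma (s + 2)‖ := by rw [← key, norm_mul, norm_mul]
    _ ≤ _ := hG

/-- One Gamma factor supplies integrability. The other two are bounded, and the power has constant
modulus `z ^ c` on the line. -/
theorem integrable_Gamma_mul_Gamma_mul_Gamma_mul_cpow {a b d z : ℝ} (c : ℝ) (ha : 0 < a)
    (hb : 0 < b) (hd : 0 < d) (hz : 0 < z) :
    Integrable fun t : ℝ => Complex.Gamma (a - t * Complex.I) * Complex.Gamma (b - t * Complex.I) *
      Complex.Gamma (d + t * Complex.I) * (z : ℂ) ^ ((c : ℂ) + t * Complex.I) := by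
  have hneg : ∀ {e : ℝ}, 0 < e → Continuous fun t : ℝ => Complex.Gamma (e - t * Complex.I) := by
    intro e he
    refine ((continuous_Gamma_vertical he).comp continuous_neg).congr fun t => ?_
    simp [sub_eq_add_neg]
  have hpow : Continuous fun t : ℝ => (z : ℂ) ^ ((c : ℂ) + t * Complex.I) :=
    Continuous.const_cpow (by fun_prop) (Or.inl (by exact_mod_cast hz.ne'))
  have hI := (integrable_Gamma_vertical hd).bdd_mul (f := fun t : ℝ =>
    Complex.Gamma (a - t * Complex.I) * Complex.Gamma (b - t * Complex.I) *
      (z : ℂ) ^ ((c : ℂ) + t * Complex.I)) (c := Real.Gamma a * Real.Gamma b * z ^ c)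
    (((hneg ha).mul (hneg hb)).mul hpow).aestronglyMeasurable
    (Filter.Eventually.of_forall fun t => by
      have h1 := norm_complex_Gamma_le (s := a - t * Complex.I) (by simpa using ha)
      have h2 := norm_complex_Gamma_le (s := b - t * Complex.I) (by simpa using hb)
      have h3 : ‖(z : ℂ) ^ ((c : ℂ) + t * Complex.I)‖ = z ^ c := by
        rw [Complex.norm_cpow_eq_rpow_re_of_pos hz]; simp
      rw [norm_mul, norm_mul, h3]
      simp only [Complex.sub_re, Complex.ofReal_re, Complex.mul_re, Complex.I_re, mul_zero,
        Complex.ofReal_im, Complex.I_im, zero_mul, sub_self, sub_zero] at h1 h2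
      have := Real.Gamma_pos_of_pos ha
      gcongr)
  refine hI.congr (Filter.Eventually.of_forall fun t => ?_)
  simp only
  ring

/-! ### Mellin transforms of the factor densities -/

theorem hasMellin_exp_neg_mul {k : ℝ} (hk : 0 < k) {s : ℂ} (hs : 0 < s.re) :
    HasMellin (fun t : ℝ => (Real.exp (-(k * t)) : ℂ)) s ((k : ℂ) ^ (-s) * Complex.Gamma s) := by
  constructor
  · refine (MellinConvergent.comp_mul_left (f := fun t : ℝ => (Real.exp (-t) : ℂ)) hk).2 ?_
    refine (Complex.GammaIntegral_convergent hs).congr_fun (fun t _ => ?_) measurableSet_Ioi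
    simp [mul_comm]
  · rw [mellin_comp_mul_left (fun t : ℝ => (Real.exp (-t) : ℂ)) s hk, smul_eq_mul,
      Complex.Gamma_eq_integral hs, Complex.GammaIntegral, mellin]
    congr 2
    ext t
    simp [mul_comm]

theorem hasMellin_exp_neg_div {θ : ℝ} (hθ : 0 < θ) {s : ℂ} (hs : s.re < 0) :
    HasMellin (fun t : ℝ => (Real.exp (-(θ / t)) : ℂ)) s ((θ : ℂ) ^ s * Complex.Gamma (-s)) := by
  have h := hasMellin_exp_neg_mul hθ (s := -s) (by simpa using hs)
  rw [neg_neg] at h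
  constructor
  · have h' := (MellinConvergent.comp_rpow (f := fun t : ℝ => (Real.exp (-(θ * t)) : ℂ)) (s := s)
      (a := -1) (by norm_num)).2 (by simpa [div_neg] using h.1)
    simpa [Real.rpow_neg_one, div_eq_mul_inv] using h'
  · rw [← h.2, ← mellin_comp_inv]
    simp [div_eq_mul_inv]

theorem HasMellin.congr_Ioi {f g : ℝ → ℂ} {s M : ℂ} (hf : HasMellin f s M)
    (hfg : ∀ t, 0 < t → g t = f t) : HasMellin g s M := by
  constructor
  · exact hf.1.congr_fun (fun t ht => by rw [hfg t ht]) measurableSet_Ioi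
  · rw [← hf.2]
    exact setIntegral_congr_fun measurableSet_Ioi fun t ht => by rw [hfg t ht]

theorem hasMellin_cpow_smul {f : ℝ → ℂ} {s a M : ℂ} (hf : HasMellin f (s + a) M) :
    HasMellin (fun t => (t : ℂ) ^ a • f t) s M :=
  ⟨MellinConvergent.cpow_smul.2 hf.1, by rw [mellin_cpow_smul, hf.2]⟩

/-- Both factor densities are a constant times a power times an exponential kernel, so this shift
rule reduces them to the two transforms of the kernels. -/
theorem HasMellin.const_mul_rpow_mul {f : ℝ → ℝ} {s M : ℂ} {a : ℝ} (C : ℝ)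
    (hf : HasMellin (fun t => (f t : ℂ)) (s + a) M) :
    HasMellin (fun t => ((C * (t ^ a * f t) : ℝ) : ℂ)) s (C * M) := by
  have h := hasMellin_const_smul (hasMellin_cpow_smul hf).1 (C : ℂ)
  rw [(hasMellin_cpow_smul hf).2, smul_eq_mul] at h
  refine h.congr_Ioi fun t ht => ?_
  simp [Complex.ofReal_cpow ht.le]

theorem nakagamiSqPDF_of_pos {m Ω x : ℝ} (hm : 0 < m) (hΩ : 0 < Ω) (hx : 0 < x) :
    nakagamiSqPDF m Ω x =
      (m / Ω) ^ m / Real.Gamma m * (x ^ (m - 1) * Real.exp (-(m / Ω * x))) := by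
  rw [nakagamiSqPDF, if_pos hx, Real.div_rpow hm.le hΩ.le, div_mul_eq_mul_div m Ω x]
  have := (Real.Gamma_pos_of_pos hm).ne'
  have := (Real.rpow_pos_of_pos hΩ m).ne'
  field_simp

theorem invGammaPDF_of_pos {α θ y : ℝ} (hy : 0 < y) :
    invGammaPDF α θ y =
      θ ^ α / Real.Gamma α * (y ^ (-(α + 1)) * Real.exp (-(θ / y))) := by
  rw [invGammaPDF, if_pos hy, Real.rpow_neg hy.le]
  ring

theorem nakagamiSqPDF_of_nonpos {m Ω x : ℝ} (hx : x ≤ 0) : nakagamiSqPDF m Ω x = 0 :=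
  if_neg hx.not_gt

theorem invGammaPDF_of_nonpos {α θ y : ℝ} (hy : y ≤ 0) : invGammaPDF α θ y = 0 :=
  if_neg hy.not_gt

theorem nakagamiSqPDF_nonneg {m Ω : ℝ} (hm : 0 < m) (hΩ : 0 < Ω) (x : ℝ) :
    0 ≤ nakagamiSqPDF m Ω x := by
  have := Real.Gamma_pos_of_pos hm
  rw [nakagamiSqPDF]
  split_ifs <;> positivity

theorem invGammaPDF_nonneg {α θ : ℝ} (hα : 0 < α) (hθ : 0 < θ) (y : ℝ) :
    0 ≤ invGammaPDF α θ y := by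
  have := Real.Gamma_pos_of_pos hα
  rw [invGammaPDF]
  split_ifs <;> positivity

@[fun_prop]
theorem measurable_nakagamiSqPDF (m Ω : ℝ) : Measurable (nakagamiSqPDF m Ω) := by
  unfold nakagamiSqPDF
  exact Measurable.ite measurableSet_Ioi (by fun_prop) measurable_const

@[fun_prop]
theorem measurable_invGammaPDF (α θ : ℝ) : Measurable (invGammaPDF α θ) := by
  unfold invGammaPDF
  exact Measurable.ite measurableSet_Ioi (by fun_prop) measurable_const

theorem hasMellin_nakagamiSqPDF {m Ω : ℝ} (hm : 0 < m) (hΩ : 0 < Ω) {s : ℂ}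
    (hs : 0 < s.re + m - 1) :
    HasMellin (fun t => (nakagamiSqPDF m Ω t : ℂ)) s
      (((m / Ω : ℝ) : ℂ) ^ (1 - s) * Complex.Gamma (m + s - 1) / Real.Gamma m) := by
  have hk : 0 < m / Ω := by positivity
  have h := HasMellin.const_mul_rpow_mul (s := s) (a := m - 1) ((m / Ω) ^ m / Real.Gamma m)
    (hasMellin_exp_neg_mul hk (s := s + (m - 1 : ℝ)) (by simp; linarith))
  have e : (((m / Ω : ℝ) : ℂ) ^ (1 - s) * Complex.Gamma (m + s - 1) / Real.Gamma m) =
      (((m / Ω) ^ m / Real.Gamma m : ℝ) : ℂ) *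
        (((m / Ω : ℝ) : ℂ) ^ (-(s + ((m - 1 : ℝ) : ℂ))) *
          Complex.Gamma (s + ((m - 1 : ℝ) : ℂ))) := by
    rw [Complex.ofReal_div (_ ^ _), Complex.ofReal_cpow hk.le,
      show 1 - s = (m : ℂ) + -(s + ((m - 1 : ℝ) : ℂ)) by push_cast; ring,
      Complex.cpow_add _ _ (by exact_mod_cast hk.ne'),
      show (m : ℂ) + s - 1 = s + ((m - 1 : ℝ) : ℂ) by push_cast; ring]
    ring
  rw [e]
  exact h.congr_Ioi fun t ht => by rw [nakagamiSqPDF_of_pos hm hΩ ht]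

theorem hasMellin_invGammaPDF {α θ : ℝ} (hθ : 0 < θ) {s : ℂ}
    (hs : s.re < α + 1) :
    HasMellin (fun t => (invGammaPDF α θ t : ℂ)) s
      ((θ : ℂ) ^ (s - 1) * Complex.Gamma (α + 1 - s) / Real.Gamma α) := by
  have h := HasMellin.const_mul_rpow_mul (s := s) (a := -(α + 1)) (θ ^ α / Real.Gamma α)
    (hasMellin_exp_neg_div hθ (s := s + (-(α + 1) : ℝ)) (by simp; linarith))
  have e : ((θ : ℂ) ^ (s - 1) * Complex.Gamma (α + 1 - s) / Real.Gamma α) =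
      ((θ ^ α / Real.Gamma α : ℝ) : ℂ) *
        ((θ : ℂ) ^ (s + ((-(α + 1) : ℝ) : ℂ)) *
          Complex.Gamma (-(s + ((-(α + 1) : ℝ) : ℂ)))) := by
    rw [Complex.ofReal_div (_ ^ _), Complex.ofReal_cpow hθ.le,
      show s - 1 = (α : ℂ) + (s + ((-(α + 1) : ℝ) : ℂ)) by push_cast; ring,
      Complex.cpow_add _ _ (by exact_mod_cast hθ.ne'),
      show (α : ℂ) + 1 - s = -(s + ((-(α + 1) : ℝ) : ℂ)) by push_cast; ring]
    ring
  rw [e]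
  exact h.congr_Ioi fun t ht => by rw [invGammaPDF_of_pos ht]

/-! ### Complex moments and products of independent positive variables -/

theorem integrable_comp_densityMeasure_iff {S : Type*} [MeasurableSpace S] {P : Measure S}
    {X : S → ℝ} {f : ℝ → ℝ} (hf : Measurable f) (hf0 : ∀ x, 0 ≤ f x)
    (hX : HasLaw X (densityMeasure f) P) {φ : ℝ → ℂ} (hφ : Measurable φ) :
    Integrable (fun ω => φ (X ω)) P ↔ Integrable (fun x => (f x : ℂ) * φ x) := by
  rw [show (fun ω => φ (X ω)) = φ ∘ X from rfl, ← integrable_map_measure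
    hφ.aestronglyMeasurable hX.aemeasurable, hX.map_eq, densityMeasure,
    integrable_withDensity_iff_integrable_smul' hf.ennreal_ofReal (by simp)]
  simp [ENNReal.toReal_ofReal (hf0 _)]

theorem integral_comp_densityMeasure {S : Type*} [MeasurableSpace S] {P : Measure S}
    {X : S → ℝ} {f : ℝ → ℝ} (hf : Measurable f) (hf0 : ∀ x, 0 ≤ f x)
    (hX : HasLaw X (densityMeasure f) P) {φ : ℝ → ℂ} (hφ : Measurable φ) :
    ∫ ω, φ (X ω) ∂P = ∫ x, (f x : ℂ) * φ x := by
  rw [← integral_map hX.aemeasurable hφ.aestronglyMeasurable, hX.map_eq, densityMeasure,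
    integral_withDensity_eq_integral_toReal_smul hf.ennreal_ofReal (by simp)]
  simp [ENNReal.toReal_ofReal (hf0 _)]

/-- Since `f` vanishes off the positive half-line, the Mellin integral is the moment integral over
the whole line. -/
theorem integrable_cpow_iff_mellinConvergent {S : Type*} [MeasurableSpace S] {P : Measure S}
    {X : S → ℝ} {f : ℝ → ℝ} (hf : Measurable f) (hf0 : ∀ x, 0 ≤ f x) (hf1 : ∀ x ≤ 0, f x = 0)
    (hX : HasLaw X (densityMeasure f) P) (s : ℂ) :
    Integrable (fun ω => (X ω : ℂ) ^ (s - 1)) P ↔ MellinConvergent (fun x => (f x : ℂ)) s := by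
  rw [integrable_comp_densityMeasure_iff hf hf0 hX (φ := fun x : ℝ => (x : ℂ) ^ (s - 1))
    (by fun_prop), MellinConvergent, integrableOn_iff_integrable_of_support_subset]
  · simp [mul_comm]
  · intro x hx
    by_contra h
    exact hx (by simp [hf1 x (not_lt.1 h)])

theorem integral_cpow_eq_mellin {S : Type*} [MeasurableSpace S] {P : Measure S}
    {X : S → ℝ} {f : ℝ → ℝ} (hf : Measurable f) (hf0 : ∀ x, 0 ≤ f x) (hf1 : ∀ x ≤ 0, f x = 0)
    (hX : HasLaw X (densityMeasure f) P) (s : ℂ) :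
    ∫ ω, (X ω : ℂ) ^ (s - 1) ∂P = mellin (fun x => (f x : ℂ)) s := by
  rw [integral_comp_densityMeasure hf hf0 hX (φ := fun x : ℝ => (x : ℂ) ^ (s - 1))
    (by fun_prop), mellin, setIntegral_eq_integral_of_forall_compl_eq_zero]
  · simp [mul_comm]
  · intro x hx
    simp [hf1 x (not_lt.1 hx)]

theorem ae_pos_of_hasLaw_densityMeasure {S : Type*} [MeasurableSpace S] {P : Measure S}
    {X : S → ℝ} {f : ℝ → ℝ} (hf : Measurable f) (hf1 : ∀ x ≤ 0, f x = 0)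
    (hX : HasLaw X (densityMeasure f) P) : ∀ᵐ ω ∂P, 0 < X ω := by
  rw [hX.ae_iff (p := fun x => 0 < x) (measurableSet_setOfPred.1 measurableSet_Ioi), densityMeasure,
    ae_withDensity_iff hf.ennreal_ofReal]
  refine Filter.Eventually.of_forall fun x hx => ?_
  by_contra h
  exact hx (by simp [hf1 x (not_lt.1 h)])

/-- The Mellin transform of the density of a product of independent positive random variables is
the product of the Mellin transforms. -/
theorem hasMellin_of_indepFun_mul {S : Type*} [MeasurableSpace S] {P : Measure S}
    {X Y : S → ℝ} {f g h : ℝ → ℝ} (hf : Measurable f) (hf0 : ∀ x, 0 ≤ f x)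
    (hf1 : ∀ x ≤ 0, f x = 0) (hg : Measurable g) (hg0 : ∀ x, 0 ≤ g x)
    (hg1 : ∀ x ≤ 0, g x = 0) (hh : Measurable h) (hh0 : ∀ x, 0 ≤ h x)
    (hh1 : ∀ x ≤ 0, h x = 0) (hX : HasLaw X (densityMeasure f) P)
    (hY : HasLaw Y (densityMeasure g) P)
    (hXY : HasLaw (fun ω => X ω * Y ω) (densityMeasure h) P) (hind : IndepFun X Y P) {s M N : ℂ}
    (hM : HasMellin (fun x => (f x : ℂ)) s M) (hN : HasMellin (fun x => (g x : ℂ)) s N) :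
    HasMellin (fun x => (h x : ℂ)) s (M * N) := by
  have hφ : Measurable fun x : ℝ => (x : ℂ) ^ (s - 1) := by fun_prop
  have hind' : IndepFun (fun ω => (X ω : ℂ) ^ (s - 1)) (fun ω => (Y ω : ℂ) ^ (s - 1)) P :=
    hind.comp hφ hφ
  have hfi := (integrable_cpow_iff_mellinConvergent hf hf0 hf1 hX s).2 hM.1
  have hgi := (integrable_cpow_iff_mellinConvergent hg hg0 hg1 hY s).2 hN.1
  -- Complex powers are multiplicative on nonnegative reals, and both variables are almost surely
  -- positive.
  have hae : (fun ω => (X ω : ℂ) ^ (s - 1) * (Y ω : ℂ) ^ (s - 1)) =ᵐ[P]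
      fun ω => ((X ω * Y ω : ℝ) : ℂ) ^ (s - 1) := by
    filter_upwards [ae_pos_of_hasLaw_densityMeasure hf hf1 hX,
      ae_pos_of_hasLaw_densityMeasure hg hg1 hY] with ω h1 h2
    rw [Complex.ofReal_mul, Complex.mul_cpow_ofReal_nonneg h1.le h2.le]
  constructor
  · rw [← integrable_cpow_iff_mellinConvergent hh hh0 hh1 hXY]
    exact (hind'.integrable_mul hfi hgi).congr hae
  · rw [← integral_cpow_eq_mellin hh hh0 hh1 hXY, ← integral_congr_ae hae,
      hind'.integral_fun_mul_eq_mul_integral hfi.aestronglyMeasurable hgi.aestronglyMeasurable,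
      integral_cpow_eq_mellin hf hf0 hf1 hX, integral_cpow_eq_mellin hg hg0 hg1 hY, hM.2, hN.2]

/-- The product of two independent positive random variables with densities `f` and `g` has
density `z ↦ ∫ f (z / y) * g y / y`. -/
theorem hasLaw_mul_densityMeasure {S : Type*} [MeasurableSpace S] {P : Measure S}
    [IsFiniteMeasure P] {X Y : S → ℝ} {f g h : ℝ → ℝ} (hf : Measurable f) (hf0 : ∀ x, 0 ≤ f x)
    (hf1 : ∀ x ≤ 0, f x = 0) (hg : Measurable g) (hg0 : ∀ x, 0 ≤ g x)
    (hg1 : ∀ x ≤ 0, g x = 0) (hh1 : ∀ x ≤ 0, h x = 0)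
    (hX : HasLaw X (densityMeasure f) P) (hY : HasLaw Y (densityMeasure g) P)
    (hind : IndepFun X Y P)
    (hint : ∀ z, 0 < z → IntegrableOn (fun y => f (z / y) * g y / y) (Ioi 0))
    (hval : ∀ z, 0 < z → h z = ∫ y in Ioi 0, f (z / y) * g y / y) :
    HasLaw (fun ω => X ω * Y ω) (densityMeasure h) P := by
  -- Integrability is used only here, to pass to lower Lebesgue integrals; the rest is Tonelli.
  have hdens : ∀ z, ENNReal.ofReal (h z) =
      ∫⁻ y in Ioi 0, ENNReal.ofReal (f (z / y) * g y / y) := by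
    intro z
    rcases le_or_gt z 0 with hz | hz
    · rw [hh1 z hz, ENNReal.ofReal_zero]
      refine ((setLIntegral_congr_fun measurableSet_Ioi fun y hy => ?_).trans
        lintegral_zero).symm
      rw [mem_Ioi] at hy
      simp [hf1 (z / y) (div_nonpos_of_nonpos_of_nonneg hz hy.le)]
    · rw [hval z hz, ofReal_integral_eq_lintegral_ofReal (hint z hz)]
      filter_upwards [ae_restrict_mem measurableSet_Ioi] with y hy
      rw [mem_Ioi] at hy
      exact div_nonneg (mul_nonneg (hf0 _) (hg0 _)) hy.le
  refine ⟨hX.aemeasurable.mul hY.aemeasurable, ?_⟩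
  have hmap : P.map (fun ω => X ω * Y ω) =
      (((densityMeasure f).prod (densityMeasure g)).map fun p : ℝ × ℝ => p.1 * p.2) := by
    have := (indepFun_iff_map_prod_eq_prod_map_map hX.aemeasurable hY.aemeasurable).1 hind
    rw [← hX.map_eq, ← hY.map_eq, ← this, AEMeasurable.map_map_of_aemeasurable (by fun_prop)
      (hX.aemeasurable.prodMk hY.aemeasurable)]
    rfl
  have : IsFiniteMeasure (densityMeasure f) := hX.map_eq ▸ inferInstance
  have : IsFiniteMeasure (densityMeasure g) := hY.map_eq ▸ inferInstance
  rw [hmap]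
  ext s hs
  have hind : Measurable (s.indicator (1 : ℝ → ENNReal)) := measurable_one.indicator hs
  rw [← lintegral_indicator_one hs, lintegral_map hind (by fun_prop),
    lintegral_prod_symm' _ (by fun_prop), densityMeasure, densityMeasure, densityMeasure,
    withDensity_apply _ hs, ← lintegral_indicator hs]
  rw [lintegral_withDensity_eq_lintegral_mul _ hg.ennreal_ofReal
    (Measurable.lintegral_prod_left' (f := fun p : ℝ × ℝ =>
      s.indicator (1 : ℝ → ENNReal) (p.1 * p.2)) (by fun_prop))]
  have hstep : ∀ y, ((fun y => ENNReal.ofReal (g y)) * fun y => ∫⁻ x, s.indicator 1 (x * y)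
      ∂(volume.withDensity fun x => ENNReal.ofReal (f x))) y = (Ioi (0 : ℝ)).indicator
      (fun y => ∫⁻ z, s.indicator 1 z * ENNReal.ofReal (f (z / y) * g y / y)) y := by
    intro y
    rcases le_or_gt y 0 with hy | hy
    · simp [hg1 y hy, hy.not_gt]
    · rw [indicator_of_mem (mem_Ioi.2 hy), Pi.mul_apply,
        lintegral_withDensity_eq_lintegral_mul _ hf.ennreal_ofReal (by fun_prop)]
      have hsub := lintegral_map (μ := volume) (g := fun x => x * y)
        (f := fun z => s.indicator 1 z * ENNReal.ofReal (f (z / y) * g y / y)) (by fun_prop)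
        (by fun_prop)
      rw [Real.map_volume_mul_right hy.ne', lintegral_smul_measure, smul_eq_mul] at hsub
      symm
      -- Writing `1 = y * y⁻¹` supplies the Jacobian `y⁻¹` of `x ↦ x * y`; the remaining `y` cancels
      -- the division by `y` in the convolution.
      rw [← one_mul (∫⁻ z, _), ← ENNReal.ofReal_one, ← mul_inv_cancel₀ hy.ne',
        ← abs_of_pos (inv_pos.2 hy), ENNReal.ofReal_mul hy.le, mul_assoc, hsub,
        ← lintegral_const_mul _ (by fun_prop), ← lintegral_const_mul _ (by fun_prop)]
      refine lintegral_congr fun x => ?_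
      rw [Pi.mul_apply, mul_div_cancel_right₀ x hy.ne', mul_left_comm (ENNReal.ofReal y),
        ← ENNReal.ofReal_mul hy.le, mul_div_cancel₀ _ hy.ne', ENNReal.ofReal_mul (hf0 x)]
      ring
  simp_rw [hstep]
  rw [lintegral_indicator measurableSet_Ioi, lintegral_lintegral_swap (by fun_prop)]
  refine lintegral_congr fun z => ?_
  rw [lintegral_const_mul _ (by fun_prop), ← hdens]
  by_cases hz : z ∈ s <;> simp [hz]

/-! ### Inverse-gamma integrals and Tricomi's function -/

theorem integrableOn_rpow_mul_exp_neg_mul {a r : ℝ} (ha : 0 < a) (hr : 0 < r) :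
    IntegrableOn (fun t : ℝ => t ^ (a - 1) * Real.exp (-(r * t))) (Ioi 0) := by
  have h := integrableOn_rpow_mul_exp_neg_mul_rpow (s := a - 1) (p := 1) (b := r) (by linarith)
    one_pos hr
  simpa using h

theorem integrableOn_rpow_mul_exp_neg_div {a r : ℝ} (ha : 0 < a) (hr : 0 < r) :
    IntegrableOn (fun t : ℝ => t ^ (-(a + 1)) * Real.exp (-(r / t))) (Ioi 0) := by
  have h := (integrableOn_Ioi_comp_rpow_iff
    (fun t : ℝ => t ^ (a - 1) * Real.exp (-(r * t))) (p := -1) (by norm_num)).2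
    (integrableOn_rpow_mul_exp_neg_mul ha hr)
  refine h.congr_fun (fun t ht => ?_) measurableSet_Ioi
  rw [mem_Ioi] at ht
  simp only [abs_neg, abs_one, one_mul, smul_eq_mul]
  rw [← Real.rpow_mul ht.le, ← mul_assoc, ← Real.rpow_add ht, Real.rpow_neg_one, div_eq_mul_inv]
  ring_nf

theorem integral_rpow_mul_exp_neg_div {a r : ℝ} (ha : 0 < a) (hr : 0 < r) :
    ∫ t in Ioi 0, t ^ (-(a + 1)) * Real.exp (-(r / t)) = r ^ (-a) * Real.Gamma a := by
  rw [Real.rpow_neg hr.le, ← Real.inv_rpow hr.le, ← one_div,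
    ← Real.integral_rpow_mul_exp_neg_mul_Ioi ha hr, ← integral_comp_rpow_Ioi _ (p := -1)
    (by norm_num)]
  refine setIntegral_congr_fun measurableSet_Ioi fun t ht => ?_
  rw [mem_Ioi] at ht
  simp only [abs_neg, abs_one, one_mul, smul_eq_mul]
  rw [← Real.rpow_mul ht.le, ← mul_assoc, ← Real.rpow_add ht, Real.rpow_neg_one, div_eq_mul_inv, inv_inv]
  ring_nf

/-- The condition on `b` makes the power of `1 + t` at most one, so a Gamma integrand dominates. In
the application that exponent is `-(m₂ + α)`. -/
theorem integrableOn_tricomiU {a b z : ℝ} (ha : 0 < a) (hb : b ≤ a + 1) (hz : 0 < z) :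
    IntegrableOn (fun t : ℝ => Real.exp (-(z * t)) * t ^ (a - 1) * (1 + t) ^ (b - a - 1))
      (Ioi 0) := by
  refine (integrableOn_rpow_mul_exp_neg_mul ha hz).mono' (by fun_prop) ?_
  filter_upwards [ae_restrict_mem measurableSet_Ioi] with t ht
  rw [mem_Ioi] at ht
  rw [Real.norm_of_nonneg (by positivity), mul_comm (Real.exp _)]
  exact mul_le_of_le_one_right (by positivity)
    (Real.rpow_le_one_of_one_le_of_nonpos (by linarith) (by linarith))

theorem tricomiU_pos {a b z : ℝ} (ha : 0 < a) (hb : b ≤ a + 1) (hz : 0 < z) :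
    0 < tricomiU a b z := by
  refine mul_pos (inv_pos.2 (Real.Gamma_pos_of_pos ha)) ?_
  have hpos : ∀ t : ℝ, 0 < t →
      0 < Real.exp (-(z * t)) * t ^ (a - 1) * (1 + t) ^ (b - a - 1) := by
    intro t ht
    positivity
  rw [setIntegral_pos_iff_support_of_nonneg_ae _ (integrableOn_tricomiU ha hb hz)]
  · have hsub : Ioi (0 : ℝ) ⊆ Function.support fun t : ℝ =>
        Real.exp (-(z * t)) * t ^ (a - 1) * (1 + t) ^ (b - a - 1) := fun t ht => (hpos t ht).ne'
    rw [inter_eq_self_of_subset_right hsub]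
    simp
  · filter_upwards [ae_restrict_mem measurableSet_Ioi] with t ht using (hpos t ht).le

/-- Pointwise Mellin inversion requires continuity. The integrand decreases in `z`, so its value at
`z / 2` dominates near `z`. -/
theorem continuousAt_tricomiU {a b z : ℝ} (ha : 0 < a) (hb : b ≤ a + 1) (hz : 0 < z) :
    ContinuousAt (tricomiU a b) z := by
  refine continuousAt_const.mul (continuousAt_of_dominated
    (bound := fun t => Real.exp (-(z / 2 * t)) * t ^ (a - 1) * (1 + t) ^ (b - a - 1))
    (Filter.Eventually.of_forall fun x => by fun_prop) ?_
    (integrableOn_tricomiU ha hb (half_pos hz)) ?_)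
  · filter_upwards [lt_mem_nhds (half_lt_self hz)] with x hx
    filter_upwards [ae_restrict_mem measurableSet_Ioi] with t ht
    rw [mem_Ioi] at ht
    rw [Real.norm_of_nonneg (by positivity)]
    gcongr
  · exact Filter.Eventually.of_forall fun t => by fun_prop

/-! ### Densities of the partial product and of the SNR -/

/-- Density of the product of a squared Nakagami-`m` variable with rate `k = m / Ω` and an
independent inverse-gamma variable (a scaled beta-prime density). -/
noncomputable def nakagamiSqMulInvGammaPDF (k m α θ v : ℝ) : ℝ :=
  if 0 < v then Real.Gamma (m + α) / (Real.Gamma m * Real.Gamma α) * (k ^ m * θ ^ α) *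
    (v ^ (m - 1) * (θ + k * v) ^ (-(m + α))) else 0

/-- Density of the single-shadowing SNR, in terms of Tricomi's function. -/
noncomputable def singleShadowingPDF (m₁ m₂ α c γ : ℝ) : ℝ :=
  if 0 < γ then Real.Gamma (α + m₁) * Real.Gamma (α + m₂) *
    (1 / (Real.Gamma m₁ * Real.Gamma m₂ * Real.Gamma α)) * c ^ m₁ * γ ^ (m₁ - 1) *
      tricomiU (α + m₁) (m₁ - m₂ + 1) (c * γ) else 0

theorem nakagamiSqMulInvGammaPDF_nonneg {k m α θ : ℝ} (hk : 0 < k) (hm : 0 < m) (hα : 0 < α)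
    (hθ : 0 < θ) (v : ℝ) : 0 ≤ nakagamiSqMulInvGammaPDF k m α θ v := by
  have := Real.Gamma_pos_of_pos hm
  have := Real.Gamma_pos_of_pos hα
  have := Real.Gamma_pos_of_pos (add_pos hm hα)
  rw [nakagamiSqMulInvGammaPDF]
  split_ifs <;> positivity

theorem nakagamiSqMulInvGammaPDF_of_nonpos {k m α θ v : ℝ} (hv : v ≤ 0) :
    nakagamiSqMulInvGammaPDF k m α θ v = 0 :=
  if_neg hv.not_gt

@[fun_prop]
theorem measurable_nakagamiSqMulInvGammaPDF (k m α θ : ℝ) :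
    Measurable (nakagamiSqMulInvGammaPDF k m α θ) := by
  unfold nakagamiSqMulInvGammaPDF
  exact Measurable.ite measurableSet_Ioi (by fun_prop) measurable_const

theorem singleShadowingPDF_of_nonpos {m₁ m₂ α c γ : ℝ} (hγ : γ ≤ 0) :
    singleShadowingPDF m₁ m₂ α c γ = 0 :=
  if_neg hγ.not_gt

theorem singleShadowingPDF_pos {m₁ m₂ α c γ : ℝ} (hm₁ : 0 < m₁) (hm₂ : 0 < m₂) (hα : 0 < α)
    (hc : 0 < c) (hγ : 0 < γ) : 0 < singleShadowingPDF m₁ m₂ α c γ := by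
  have := Real.Gamma_pos_of_pos hm₁
  have := Real.Gamma_pos_of_pos hm₂
  have := Real.Gamma_pos_of_pos hα
  have := Real.Gamma_pos_of_pos (add_pos hα hm₁)
  have := Real.Gamma_pos_of_pos (add_pos hα hm₂)
  have := tricomiU_pos (a := α + m₁) (b := m₁ - m₂ + 1) (z := c * γ) (by positivity)
    (by linarith) (by positivity)
  rw [singleShadowingPDF, if_pos hγ]
  positivity

theorem singleShadowingPDF_nonneg {m₁ m₂ α c : ℝ} (hm₁ : 0 < m₁) (hm₂ : 0 < m₂) (hα : 0 < α)
    (hc : 0 < c) (γ : ℝ) : 0 ≤ singleShadowingPDF m₁ m₂ α c γ := by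
  rcases le_or_gt γ 0 with h | h
  · exact (singleShadowingPDF_of_nonpos h).ge
  · exact (singleShadowingPDF_pos hm₁ hm₂ hα hc h).le

theorem continuousAt_singleShadowingPDF {m₁ m₂ α c γ : ℝ} (hm₁ : 0 < m₁) (hm₂ : 0 < m₂)
    (hα : 0 < α) (hc : 0 < c) (hγ : 0 < γ) :
    ContinuousAt (singleShadowingPDF m₁ m₂ α c) γ := by
  have hU : ContinuousAt (fun x => tricomiU (α + m₁) (m₁ - m₂ + 1) (c * x)) γ :=
    ContinuousAt.comp (f := fun x => c * x) (continuousAt_tricomiU (by positivity) (by linarith)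
      (by positivity)) (by fun_prop)
  have h := (continuousAt_const (y := Real.Gamma (α + m₁) * Real.Gamma (α + m₂) *
    (1 / (Real.Gamma m₁ * Real.Gamma m₂ * Real.Gamma α)) * c ^ m₁)).mul
    (Real.continuousAt_rpow_const γ (m₁ - 1) (Or.inl hγ.ne')) |>.mul hU
  refine h.congr ?_
  filter_upwards [lt_mem_nhds hγ] with x hx
  rw [singleShadowingPDF, if_pos hx]
  rfl

theorem measurable_singleShadowingPDF {m₁ m₂ α c : ℝ} (hm₁ : 0 < m₁) (hm₂ : 0 < m₂)
    (hα : 0 < α) (hc : 0 < c) : Measurable (singleShadowingPDF m₁ m₂ α c) := by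
  have h : ContinuousOn (singleShadowingPDF m₁ m₂ α c) (Ioi 0) := fun γ hγ =>
    (continuousAt_singleShadowingPDF hm₁ hm₂ hα hc hγ).continuousWithinAt
  have h2 := h.measurable_piecewise (continuousOn_const (c := (0 : ℝ))) measurableSet_Ioi
  convert! h2 using 1
  ext x
  by_cases hx : 0 < x
  · simp [piecewise, hx]
  · simp [piecewise, hx, singleShadowingPDF]

/-- The two exponentials merge, so the convolution integrand at `z` is an unnormalised inverse-gamma
density with shape `m + α` and scale `θ + (m / Ω) z`. -/
theorem hasLaw_nakagamiSq_mul_invGamma {S : Type*} [MeasurableSpace S] {P : Measure S}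
    [IsFiniteMeasure P] {X Y : S → ℝ} {m Ω α θ : ℝ} (hm : 0 < m) (hΩ : 0 < Ω) (hα : 0 < α)
    (hθ : 0 < θ) (hX : HasLaw X (densityMeasure (nakagamiSqPDF m Ω)) P)
    (hY : HasLaw Y (densityMeasure (invGammaPDF α θ)) P) (hind : IndepFun X Y P) :
    HasLaw (fun ω => X ω * Y ω) (densityMeasure (nakagamiSqMulInvGammaPDF (m / Ω) m α θ)) P := by
  have hk : 0 < m / Ω := by positivity
  have hkey : ∀ z, 0 < z → ∀ y ∈ Ioi (0 : ℝ),
      nakagamiSqPDF m Ω (z / y) * invGammaPDF α θ y / y =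
        ((m / Ω) ^ m / Real.Gamma m * (θ ^ α / Real.Gamma α) * z ^ (m - 1)) *
          (y ^ (-(m + α + 1)) * Real.exp (-((θ + m / Ω * z) / y))) := by
    intro z hz y hy
    rw [mem_Ioi] at hy
    have e : y ^ (-(m + α + 1)) = y ^ (-(α + 1)) / y ^ (m - 1) / y := by
      rw [show -(m + α + 1) = -(α + 1) - (m - 1) - 1 by ring, Real.rpow_sub hy _ 1,
        Real.rpow_sub hy (-(α + 1)), Real.rpow_one]
    rw [nakagamiSqPDF_of_pos hm hΩ (by positivity), invGammaPDF_of_pos hy,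
      Real.div_rpow hz.le hy.le, show -((θ + m / Ω * z) / y) = -(m / Ω * (z / y)) + -(θ / y) by
        ring, Real.exp_add, e]
    ring
  refine hasLaw_mul_densityMeasure (by fun_prop) (nakagamiSqPDF_nonneg hm hΩ)
    (fun _ => nakagamiSqPDF_of_nonpos) (by fun_prop) (invGammaPDF_nonneg hα hθ)
    (fun _ => invGammaPDF_of_nonpos) (fun _ => nakagamiSqMulInvGammaPDF_of_nonpos) hX hY hind
    (fun z hz => ?_) (fun z hz => ?_)
  · exact IntegrableOn.congr_fun ((integrableOn_rpow_mul_exp_neg_div (add_pos hm hα)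
      (by positivity)).const_mul _) (fun y hy => (hkey z hz y hy).symm) measurableSet_Ioi
  · rw [setIntegral_congr_fun measurableSet_Ioi (hkey z hz), integral_const_mul,
      integral_rpow_mul_exp_neg_div (add_pos hm hα) (by positivity), nakagamiSqMulInvGammaPDF,
      if_pos hz]
    ring

theorem singleShadowing_rpow_identity {k₁ k₂ θ γ t u : ℝ} (m₁ m₂ α : ℝ) (hk₁ : 0 < k₁)
    (hk₂ : 0 < k₂) (hθ : 0 < θ) (hγ : 0 < γ) (ht : 0 < t) (hu : 0 < u) :
    k₂ ^ m₂ * θ ^ α * ((θ / (k₂ * t)) ^ (m₂ - 1) * (θ * u / t) ^ (-(m₂ + α))) *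
      (k₁ ^ m₁ * (k₂ * γ / θ * t) ^ (m₁ - 1)) / t =
    (k₁ * k₂ / θ) ^ m₁ * γ ^ (m₁ - 1) * (t ^ (α + m₁ - 1) * u ^ (-(m₂ + α))) := by
  -- With every base written as an exponential, the claim becomes a polynomial identity between
  -- exponents.
  obtain ⟨a, rfl⟩ : ∃ a, Real.exp a = k₁ := ⟨_, Real.exp_log hk₁⟩
  obtain ⟨b, rfl⟩ : ∃ a, Real.exp a = k₂ := ⟨_, Real.exp_log hk₂⟩
  obtain ⟨c, rfl⟩ : ∃ a, Real.exp a = θ := ⟨_, Real.exp_log hθ⟩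
  obtain ⟨d, rfl⟩ : ∃ a, Real.exp a = γ := ⟨_, Real.exp_log hγ⟩
  obtain ⟨e, rfl⟩ : ∃ a, Real.exp a = t := ⟨_, Real.exp_log ht⟩
  obtain ⟨f, rfl⟩ : ∃ a, Real.exp a = u := ⟨_, Real.exp_log hu⟩
  simp only [← Real.exp_add, ← Real.exp_sub, ← Real.exp_mul]
  congr 1
  ring

/-- Substituting `y = (k₂ z / θ) t` turns `θ + k₂ z / y` into `θ (1 + t) / t`, which produces the
factor `1 + t` of Tricomi's integrand. -/
theorem hasLaw_singleShadowing {S : Type*} [MeasurableSpace S] {P : Measure S}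
    [IsFiniteMeasure P] {X Y : S → ℝ} {k₂ m₁ m₂ Ω α θ : ℝ} (hm₁ : 0 < m₁) (hm₂ : 0 < m₂)
    (hΩ : 0 < Ω) (hk₂ : 0 < k₂) (hα : 0 < α) (hθ : 0 < θ)
    (hX : HasLaw X (densityMeasure (nakagamiSqMulInvGammaPDF k₂ m₂ α θ)) P)
    (hY : HasLaw Y (densityMeasure (nakagamiSqPDF m₁ Ω)) P) (hind : IndepFun X Y P) :
    HasLaw (fun ω => X ω * Y ω)
      (densityMeasure (singleShadowingPDF m₁ m₂ α (m₁ / Ω * k₂ / θ))) P := by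
  have hk : 0 < m₁ / Ω := by positivity
  have hkey : ∀ z, 0 < z → ∀ t ∈ Ioi (0 : ℝ),
      nakagamiSqMulInvGammaPDF k₂ m₂ α θ (z / (k₂ * z / θ * t)) *
        nakagamiSqPDF m₁ Ω (k₂ * z / θ * t) / (k₂ * z / θ * t) =
        ((k₂ * z / θ)⁻¹ * (Real.Gamma (α + m₂) *
          (1 / (Real.Gamma m₁ * Real.Gamma m₂ * Real.Gamma α)) * (m₁ / Ω * k₂ / θ) ^ m₁ *
          z ^ (m₁ - 1))) * (Real.exp (-(m₁ / Ω * k₂ / θ * z * t)) * t ^ (α + m₁ - 1) *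
            (1 + t) ^ (m₁ - m₂ + 1 - (α + m₁) - 1)) := by
    intro z hz t ht
    rw [mem_Ioi] at ht
    have hid := singleShadowing_rpow_identity m₁ m₂ α hk hk₂ hθ hz ht (u := 1 + t)
      (by positivity)
    have e1 : z / (k₂ * z / θ * t) = θ / (k₂ * t) := by field_simp
    have e2 : θ + k₂ * (θ / (k₂ * t)) = θ * (1 + t) / t := by field_simp; ring
    have e3 : m₁ / Ω * (k₂ * z / θ * t) = m₁ / Ω * k₂ / θ * z * t := by ring
    rw [nakagamiSqPDF_of_pos hm₁ hΩ (by positivity), e1, nakagamiSqMulInvGammaPDF,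
      if_pos (by positivity), e2, e3,
      show m₁ - m₂ + 1 - (α + m₁) - 1 = -(m₂ + α) by ring, add_comm α m₂]
    linear_combination ((k₂ * z / θ)⁻¹ * Real.Gamma (m₂ + α) / (Real.Gamma m₁ * Real.Gamma m₂ *
      Real.Gamma α) * Real.exp (-(m₁ / Ω * k₂ / θ * z * t))) * hid
  refine hasLaw_mul_densityMeasure (by fun_prop)
    (nakagamiSqMulInvGammaPDF_nonneg hk₂ hm₂ hα hθ)
    (fun _ => nakagamiSqMulInvGammaPDF_of_nonpos) (by fun_prop) (nakagamiSqPDF_nonneg hm₁ hΩ)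
    (fun _ => nakagamiSqPDF_of_nonpos) (fun _ => singleShadowingPDF_of_nonpos) hX hY hind
    (fun z hz => ?_) (fun z hz => ?_)
  · have hκ : 0 < k₂ * z / θ := by positivity
    have h := (integrableOn_Ioi_comp_mul_left_iff (fun y =>
      nakagamiSqMulInvGammaPDF k₂ m₂ α θ (z / y) * nakagamiSqPDF m₁ Ω y / y) 0 hκ).1
    rw [mul_zero] at h
    exact h (IntegrableOn.congr_fun ((integrableOn_tricomiU (add_pos hα hm₁)
      (b := m₁ - m₂ + 1) (by linarith) (by positivity)).const_mul _)
      (fun y hy => (hkey z hz y hy).symm) measurableSet_Ioi)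
  · have hκ : 0 < k₂ * z / θ := by positivity
    have h := integral_comp_mul_left_Ioi (fun y =>
      nakagamiSqMulInvGammaPDF k₂ m₂ α θ (z / y) * nakagamiSqPDF m₁ Ω y / y) 0 hκ
    rw [mul_zero, setIntegral_congr_fun measurableSet_Ioi (hkey z hz), integral_const_mul,
      smul_eq_mul, mul_assoc] at h
    rw [← mul_left_cancel₀ (inv_pos.2 hκ).ne' h, singleShadowingPDF, if_pos hz, tricomiU]
    have := (Real.Gamma_pos_of_pos (add_pos hα hm₁)).ne'
    field_simp

/-! ### The Mellin–Barnes integral and Mellin inversion -/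

theorem meijerIntegrand_two_one (m₁ m₂ α : ℝ) (z s : ℂ) :
    meijerIntegrand 2 1 ![1 - (α : ℂ)] ![(m₁ : ℂ), (m₂ : ℂ)] z s =
      Complex.Gamma (m₁ - s) * Complex.Gamma (m₂ - s) * Complex.Gamma (α + s) * z ^ s := by
  simp [meijerIntegrand, Finset.prod_filter, Fin.prod_univ_two]

theorem integrable_meijerIntegrand_two_one {m₁ m₂ α z c : ℝ} (hz : 0 < z) (hc : -α < c)
    (hc₁ : c < m₁) (hc₂ : c < m₂) :
    Integrable fun t : ℝ => meijerIntegrand 2 1 ![1 - (α : ℂ)] ![(m₁ : ℂ), (m₂ : ℂ)] (z : ℂ)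
      ((c : ℂ) + (t : ℂ) * Complex.I) := by
  refine (integrable_Gamma_mul_Gamma_mul_Gamma_mul_cpow c (sub_pos.2 hc₁) (sub_pos.2 hc₂)
    (neg_lt_iff_pos_add'.1 hc) hz).congr (Filter.Eventually.of_forall fun t => ?_)
  simp only [meijerIntegrand_two_one]
  push_cast
  ring_nf

theorem meijerSeparates_two_one_iff {m₁ m₂ α c : ℝ} :
    MeijerSeparates 2 1 ![1 - (α : ℂ)] ![(m₁ : ℂ), (m₂ : ℂ)] c ↔ -α < c ∧ c < m₁ ∧ c < m₂ := by
  simp [MeijerSeparates, Fin.forall_fin_two, and_comm, and_assoc]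

/-- Mellin inversion: a function whose Mellin transform is the `G^{2,1}_{1,2}` integrand is given
by the Mellin-Barnes integral along every separating line. -/
theorem eq_mellinBarnes_of_hasMellin {m₁ m₂ α κ K c γ : ℝ} {f : ℝ → ℂ} (hκ : 0 < κ)
    (hγ : 0 < γ) (hc : -α < c) (hc₁ : c < m₁) (hc₂ : c < m₂) (hf : ContinuousAt f γ)
    (hM : ∀ s : ℂ, s.re = 1 - c → HasMellin f s
      (K * meijerIntegrand 2 1 ![1 - (α : ℂ)] ![(m₁ : ℂ), (m₂ : ℂ)] (κ : ℂ) (1 - s))) :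
    f γ = K * (γ : ℂ)⁻¹ *
      mellinBarnes 2 1 ![1 - (α : ℂ)] ![(m₁ : ℂ), (m₂ : ℂ)] c ((κ * γ : ℝ) : ℂ) := by
  have hγ' : (γ : ℂ) ≠ 0 := by exact_mod_cast hγ.ne'
  -- The map `s ↦ 1 - s` carries the line of abscissa `1 - c` to that of abscissa `c` and reverses
  -- its direction; the sign is removed at the end by `t ↦ -t`.
  have hline : ∀ y : ℝ, mellin f (((1 - c : ℝ) : ℂ) + y * Complex.I) =
      K * meijerIntegrand 2 1 ![1 - (α : ℂ)] ![(m₁ : ℂ), (m₂ : ℂ)] (κ : ℂ)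
        ((c : ℂ) + ((-y : ℝ) : ℂ) * Complex.I) := by
    intro y
    rw [(hM _ (by simp)).2]
    congr 2
    push_cast
    ring
  have hvert : Complex.VerticalIntegrable (mellin f) (1 - c) := by
    rw [Complex.VerticalIntegrable]
    simp_rw [hline]
    exact ((integrable_meijerIntegrand_two_one hκ hc hc₁ hc₂).comp_neg).const_mul _
  have hinv := mellinInv_mellin_eq (1 - c) f hγ (hM _ (by simp)).1 hvert hf
  rw [← hinv, mellinInv, mellinBarnes]
  have hint : ∀ y : ℝ, (γ : ℂ) ^ (-(((1 - c : ℝ) : ℂ) + y * Complex.I)) •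
      mellin f (((1 - c : ℝ) : ℂ) + y * Complex.I) = K * (γ : ℂ)⁻¹ *
        meijerIntegrand 2 1 ![1 - (α : ℂ)] ![(m₁ : ℂ), (m₂ : ℂ)] ((κ * γ : ℝ) : ℂ)
          ((c : ℂ) + ((-y : ℝ) : ℂ) * Complex.I) := by
    intro y
    rw [hline, meijerIntegrand_two_one, meijerIntegrand_two_one, Complex.ofReal_mul κ γ,
      Complex.mul_cpow_ofReal_nonneg hκ.le hγ.le,
      show -(((1 - c : ℝ) : ℂ) + y * Complex.I) =
        -1 + ((c : ℂ) + ((-y : ℝ) : ℂ) * Complex.I) by push_cast; ring,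
      Complex.cpow_add _ _ hγ', Complex.cpow_neg_one, smul_eq_mul]
    ring
  simp_rw [hint]
  rw [integral_const_mul, integral_neg_eq_self (fun y : ℝ =>
    meijerIntegrand 2 1 ![1 - (α : ℂ)] ![(m₁ : ℂ), (m₂ : ℂ)] ((κ * γ : ℝ) : ℂ)
      ((c : ℂ) + (y : ℂ) * Complex.I)), Complex.real_smul]
  push_cast
  ring

/-- The bounds on `s` say that `1 - s` lies in the strip `-α < Re < min(m₁, m₂)`, where all three
factor transforms converge. -/
theorem hasMellin_singleShadowingPDF {S : Type*} [MeasurableSpace S] {P : Measure S}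
    [IsFiniteMeasure P] {A B J : S → ℝ} {m₁ m₂ Ω α θ : ℝ} (hm₁ : 0 < m₁) (hm₂ : 0 < m₂)
    (hΩ : 0 < Ω) (hα : 0 < α) (hθ : 0 < θ)
    (hA : HasLaw A (densityMeasure (nakagamiSqPDF m₁ Ω)) P)
    (hB : HasLaw B (densityMeasure (nakagamiSqPDF m₂ Ω)) P)
    (hJ : HasLaw J (densityMeasure (invGammaPDF α θ)) P) (hBJ : IndepFun B J P)
    (hBJA : IndepFun (fun ω => B ω * J ω) A P) {s : ℂ} (hs₁ : 0 < s.re + m₁ - 1)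
    (hs₂ : 0 < s.re + m₂ - 1) (hs : s.re < α + 1) :
    HasMellin (fun x => (singleShadowingPDF m₁ m₂ α (m₁ / Ω * (m₂ / Ω) / θ) x : ℂ)) s
      (((1 / (Real.Gamma m₁ * Real.Gamma m₂ * Real.Gamma α) : ℝ) : ℂ) *
        meijerIntegrand 2 1 ![1 - (α : ℂ)] ![(m₁ : ℂ), (m₂ : ℂ)]
          ((m₁ / Ω * (m₂ / Ω) / θ : ℝ) : ℂ) (1 - s)) := by
  have hk₁ : 0 < m₁ / Ω := by positivity
  have hk₂ : 0 < m₂ / Ω := by positivity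
  have hc : 0 < m₁ / Ω * (m₂ / Ω) / θ := by positivity
  have hlaw := hasLaw_nakagamiSq_mul_invGamma hm₂ hΩ hα hθ hB hJ hBJ
  have hMBJ := hasMellin_of_indepFun_mul (by fun_prop) (nakagamiSqPDF_nonneg hm₂ hΩ)
    (fun _ => nakagamiSqPDF_of_nonpos) (by fun_prop) (invGammaPDF_nonneg hα hθ)
    (fun _ => invGammaPDF_of_nonpos) (by fun_prop)
    (nakagamiSqMulInvGammaPDF_nonneg hk₂ hm₂ hα hθ)
    (fun _ => nakagamiSqMulInvGammaPDF_of_nonpos) hB hJ hlaw hBJ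
    (hasMellin_nakagamiSqPDF hm₂ hΩ hs₂) (hasMellin_invGammaPDF hθ hs)
  have hM := hasMellin_of_indepFun_mul (by fun_prop)
    (nakagamiSqMulInvGammaPDF_nonneg hk₂ hm₂ hα hθ)
    (fun _ => nakagamiSqMulInvGammaPDF_of_nonpos) (by fun_prop) (nakagamiSqPDF_nonneg hm₁ hΩ)
    (fun _ => nakagamiSqPDF_of_nonpos) (measurable_singleShadowingPDF hm₁ hm₂ hα hc)
    (singleShadowingPDF_nonneg hm₁ hm₂ hα hc) (fun _ => singleShadowingPDF_of_nonpos) hlaw hA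
    (hasLaw_singleShadowing hm₁ hm₂ hΩ hk₂ hα hθ hlaw hA hBJA) hBJA hMBJ
    (hasMellin_nakagamiSqPDF hm₁ hΩ hs₁)
  convert! hM using 1
  have hdiv : ((m₁ / Ω * (m₂ / Ω) / θ : ℝ) : ℂ) ^ (1 - s) =
      ((m₁ / Ω : ℝ) : ℂ) ^ (1 - s) * ((m₂ / Ω : ℝ) : ℂ) ^ (1 - s) * (θ : ℂ) ^ (s - 1) := by
    rw [div_eq_mul_inv _ θ, Complex.ofReal_mul, Complex.mul_cpow_ofReal_nonneg (by positivity)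
      (by positivity), Complex.ofReal_mul, Complex.mul_cpow_ofReal_nonneg hk₁.le hk₂.le,
      Complex.ofReal_inv, Complex.inv_cpow _ _ (by
        rw [Complex.arg_ofReal_of_nonneg hθ.le]; exact Real.pi_pos.ne), ← Complex.cpow_neg,
      neg_sub]
  rw [meijerIntegrand_two_one, hdiv, show (m₁ : ℂ) - (1 - s) = m₁ + s - 1 by ring,
    show (m₂ : ℂ) - (1 - s) = m₂ + s - 1 by ring, show (α : ℂ) + (1 - s) = α + 1 - s by ring]
  push_cast
  ring

theorem integrable_and_integral_of_hasMellin_two {S : Type*} [MeasurableSpace S] {P : Measure S}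
    {X : S → ℝ} {f : ℝ → ℝ} (hf : Measurable f) (hf0 : ∀ x, 0 ≤ f x) (hf1 : ∀ x ≤ 0, f x = 0)
    (hX : HasLaw X (densityMeasure f) P) {M : ℝ} (hM : HasMellin (fun x => (f x : ℂ)) 2 M) :
    Integrable X P ∧ ∫ ω, X ω ∂P = M := by
  have h1 := (integrable_cpow_iff_mellinConvergent hf hf0 hf1 hX 2).2 hM.1
  have h2 := integral_cpow_eq_mellin hf hf0 hf1 hX 2
  rw [hM.2] at h2
  have e : (2 : ℂ) - 1 = 1 := by norm_num
  simp only [e, Complex.cpow_one] at h1 h2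
  refine ⟨by simpa using h1.re, ?_⟩
  rw [integral_complex_ofReal] at h2
  exact_mod_cast h2

/-! ### The distribution and mean of the SNR -/

theorem mainTheorem3 {S : Type*} [MeasurableSpace S] (P : Measure S) [IsProbabilityMeasure P]
    (m₁ m₂ α Ω θ γbar γtilde S₂ : ℝ)
    (hm₁ : 0 < m₁) (hm₂ : 0 < m₂) (hα : 1 < α) (hΩ : 0 < Ω) (hθ : 0 < θ)
    (hγbar : γbar = Ω ^ 2 * θ) (hγtilde : γtilde = m₁ * m₂ / γbar)
    (hS₂ : S₂ = 1 / (Real.Gamma m₁ * Real.Gamma m₂ * Real.Gamma α))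
    (N₁ N₂ I : S → ℝ) (hN₁m : Measurable N₁) (hN₂m : Measurable N₂) (hIm : Measurable I)
    (hindep : iIndepFun ![N₁, N₂, I] P)
    (hN₁ : HasLaw (fun ω => N₁ ω ^ 2) (densityMeasure (nakagamiSqPDF m₁ Ω)) P)
    (hN₂ : HasLaw (fun ω => N₂ ω ^ 2) (densityMeasure (nakagamiSqPDF m₂ Ω)) P)
    (hI : HasLaw I (densityMeasure (invGammaPDF α θ)) P) :
    (∀ γ : ℝ, 0 < γ → ∀ c : ℝ, -α < c → c < m₁ → c < m₂ →
      Integrable (fun t : ℝ => meijerIntegrand 2 1 ![1 - (α : ℂ)] ![(m₁ : ℂ), (m₂ : ℂ)]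
        ((γtilde * γ : ℝ) : ℂ) ((c : ℂ) + (t : ℂ) * Complex.I)) ∧
      mellinBarnes 2 1 ![1 - (α : ℂ)] ![(m₁ : ℂ), (m₂ : ℂ)] c ((γtilde * γ : ℝ) : ℂ) =
        meijerG 2 1 ![1 - (α : ℂ)] ![(m₁ : ℂ), (m₂ : ℂ)] ((γtilde * γ : ℝ) : ℂ)) ∧
    (∃ f : ℝ → ℝ,
      (∀ γ : ℝ, γ ≤ 0 → f γ = 0) ∧
      (∀ γ : ℝ, 0 < γ →
        0 < f γ ∧
        (f γ : ℂ) = (S₂ : ℂ) * (γ : ℂ)⁻¹ *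
          meijerG 2 1 ![1 - (α : ℂ)] ![(m₁ : ℂ), (m₂ : ℂ)] ((γtilde * γ : ℝ) : ℂ) ∧
        f γ = Real.Gamma (α + m₁) * Real.Gamma (α + m₂) * S₂ * γtilde ^ m₁ * γ ^ (m₁ - 1) *
          tricomiU (α + m₁) (m₁ - m₂ + 1) (γtilde * γ)) ∧
      HasLaw (fun ω => (N₁ ω * N₂ ω) ^ 2 * I ω) (densityMeasure f) P) ∧
    Integrable (fun ω => (N₁ ω * N₂ ω) ^ 2 * I ω) P ∧
    ∫ ω, (N₁ ω * N₂ ω) ^ 2 * I ω ∂P = γbar / (α - 1) := by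
  have hα0 : 0 < α := one_pos.trans hα
  have hκ : γtilde = m₁ / Ω * (m₂ / Ω) / θ := by
    rw [hγtilde, hγbar]; field_simp
  have hκpos : 0 < γtilde := by rw [hκ]; positivity
  have hG₁ := Real.Gamma_pos_of_pos hm₁
  have hG₂ := Real.Gamma_pos_of_pos hm₂
  have hGα := Real.Gamma_pos_of_pos hα0
  have hS₂pos : 0 < S₂ := by rw [hS₂]; positivity
  have hk₂ : 0 < m₂ / Ω := by positivity
  have hsq : iIndepFun ![fun ω => N₁ ω ^ 2, fun ω => N₂ ω ^ 2, I] P := by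
    have h := hindep.comp ![fun x => x ^ 2, fun x => x ^ 2, id] (fun i => by
      fin_cases i
      · exact measurable_id.pow_const 2
      · exact measurable_id.pow_const 2
      · exact measurable_id)
    convert! h using 1
    ext i ω
    fin_cases i <;> rfl
  have hmeas : ∀ i, Measurable (![fun ω => N₁ ω ^ 2, fun ω => N₂ ω ^ 2, I] i) := fun i => by
    fin_cases i
    · exact hN₁m.pow_const 2
    · exact hN₂m.pow_const 2
    · exact hIm
  have hBJ : IndepFun (fun ω => N₂ ω ^ 2) I P :=
    hsq.indepFun (i := 1) (j := 2) (by decide)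
  have hBJA : IndepFun (fun ω => N₂ ω ^ 2 * I ω) (fun ω => N₁ ω ^ 2) P :=
    (hsq.indepFun_mul_right hmeas 0 1 2 (by decide) (by decide)).symm
  have hlaw : HasLaw (fun ω => (N₁ ω * N₂ ω) ^ 2 * I ω)
      (densityMeasure (singleShadowingPDF m₁ m₂ α γtilde)) P := by
    rw [hκ]
    convert! hasLaw_singleShadowing hm₁ hm₂ hΩ hk₂ hα0 hθ
      (hasLaw_nakagamiSq_mul_invGamma hm₂ hΩ hα0 hθ hN₂ hI hBJ) hN₁ hBJA using 2 with ω
    ring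
  have hM : ∀ s : ℂ, 0 < s.re + m₁ - 1 → 0 < s.re + m₂ - 1 → s.re < α + 1 →
      HasMellin (fun x => (singleShadowingPDF m₁ m₂ α γtilde x : ℂ)) s
        ((S₂ : ℂ) * meijerIntegrand 2 1 ![1 - (α : ℂ)] ![(m₁ : ℂ), (m₂ : ℂ)] (γtilde : ℂ)
          (1 - s)) := fun s h₁ h₂ h => by
    rw [hκ, hS₂]
    exact hasMellin_singleShadowingPDF hm₁ hm₂ hΩ hα0 hθ hN₁ hN₂ hI hBJ hBJA h₁ h₂ h
  have hB : ∀ γ : ℝ, 0 < γ → ∀ c : ℝ, -α < c → c < m₁ → c < m₂ →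
      (singleShadowingPDF m₁ m₂ α γtilde γ : ℂ) = S₂ * (γ : ℂ)⁻¹ *
        mellinBarnes 2 1 ![1 - (α : ℂ)] ![(m₁ : ℂ), (m₂ : ℂ)] c ((γtilde * γ : ℝ) : ℂ) :=
    fun γ hγ c hc hc₁ hc₂ => eq_mellinBarnes_of_hasMellin
      (f := fun x => (singleShadowingPDF m₁ m₂ α γtilde x : ℂ)) hκpos hγ hc hc₁ hc₂
      (Complex.continuous_ofReal.continuousAt.comp
        (continuousAt_singleShadowingPDF hm₁ hm₂ hα0 hκpos hγ))
      fun s hs => hM s (by linarith) (by linarith) (by linarith)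
  -- The line `c = 0` separates because `α`, `m₁` and `m₂` are positive. The line selected inside
  -- `meijerG` is arbitrary, which is harmless since `hB` covers all of them.
  have hsep : ∃ c : ℝ, MeijerSeparates 2 1 ![1 - (α : ℂ)] ![(m₁ : ℂ), (m₂ : ℂ)] c :=
    ⟨0, meijerSeparates_two_one_iff.2 ⟨by linarith, hm₁, hm₂⟩⟩
  have hG : ∀ γ : ℝ, 0 < γ → (singleShadowingPDF m₁ m₂ α γtilde γ : ℂ) = S₂ * (γ : ℂ)⁻¹ *
      meijerG 2 1 ![1 - (α : ℂ)] ![(m₁ : ℂ), (m₂ : ℂ)] ((γtilde * γ : ℝ) : ℂ) := by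
    intro γ hγ
    obtain ⟨h, h₁, h₂⟩ := meijerSeparates_two_one_iff.1 hsep.choose_spec
    rw [meijerG, dif_pos hsep]
    exact hB γ hγ _ h h₁ h₂
  refine ⟨fun γ hγ c hc hc₁ hc₂ => ⟨integrable_meijerIntegrand_two_one (by positivity) hc hc₁ hc₂,
    ?_⟩, ⟨singleShadowingPDF m₁ m₂ α γtilde, fun γ => singleShadowingPDF_of_nonpos,
      fun γ hγ => ⟨singleShadowingPDF_pos hm₁ hm₂ hα0 hκpos hγ, hG γ hγ, ?_⟩, hlaw⟩, ?_⟩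
  -- Both integrals, multiplied by the nonzero `S₂ / γ`, equal the same density value.
  · have hne : (S₂ : ℂ) * (γ : ℂ)⁻¹ ≠ 0 :=
      mul_ne_zero (by exact_mod_cast hS₂pos.ne') (inv_ne_zero (by exact_mod_cast hγ.ne'))
    exact mul_left_cancel₀ hne ((hB γ hγ c hc hc₁ hc₂).symm.trans (hG γ hγ))
  · rw [singleShadowingPDF, if_pos hγ, hS₂]
  · refine integrable_and_integral_of_hasMellin_two
      (measurable_singleShadowingPDF hm₁ hm₂ hα0 hκpos)
      (singleShadowingPDF_nonneg hm₁ hm₂ hα0 hκpos) (fun _ => singleShadowingPDF_of_nonpos)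
      hlaw ?_
    -- The point `s = 2` corresponds to `1 - s = -1`, which lies in the strip precisely because `α >
    -- 1`.
    convert! hM 2 (by simp; linarith) (by simp; linarith) (by simp; linarith) using 1
    have hα1 : Real.Gamma α = (α - 1) * Real.Gamma (α - 1) := by
      rw [← Real.Gamma_add_one (by linarith), sub_add_cancel]
    have hα1pos := Real.Gamma_pos_of_pos (sub_pos.2 hα)
    have hα1' : α - 1 ≠ 0 := by linarith
    rw [meijerIntegrand_two_one, show (1 : ℂ) - 2 = -1 by norm_num, Complex.cpow_neg_one,
      sub_neg_eq_add, sub_neg_eq_add, ← sub_eq_add_neg]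
    rw [← Complex.ofReal_one, ← Complex.ofReal_add, ← Complex.ofReal_add, ← Complex.ofReal_sub,
      Complex.Gamma_ofReal, Complex.Gamma_ofReal, Complex.Gamma_ofReal]
    norm_cast
    -- The functional equation reduces the value to `m₁ m₂ / (γtilde (α - 1))`, which is `γbar / (α
    -- - 1)`.
    rw [Real.Gamma_add_one hm₁.ne', Real.Gamma_add_one hm₂.ne', hS₂, hα1, hγtilde, hγbar]
    field_simp
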